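/- Let $A\in\mathbb R^{n\times n}$, $B\in\mathbb R^{n\times p}$, $C\in\mathbb R^{q\times n}$. A square matrix is Schur stable if all its eigenvalues have modulus $<1$, and neutrally stable if it has no eigenvalue of modulus $>1$ and all Jordan blocks of its eigenvalues of modulus $1$ have size one. Suppose that $A$ is neutrally stable, that $(A,B)$ is stabilizable ($A+BK$ is Schur stable for some real $K$) and that $(A,C)$ is detectable ($A+LC$ is Schur stable for some real $L$). Consider the following construction of gains $K\in\mathbb R^{p\times n}$ and $L\in\mathbb R^{n\times q}$: (1) select $K$ such that $A+BK$ is Schur stable; (2) choose real matrices $U\in\mathbb R^{n\times n_1}$, $W\in\mathbb R^{n\times (n-n_1)}$ with $[U\ W]$ invertible and $[U\ W]^{-1}A[U\ W]=\begin{bmatrix}M&0\\0&X\end{bmatrix}$, $M$ orthogonal, $X$ Schur stable; (3) choose $V\in\mathbb R^{m\times n_1}$ with $VV^T=I_m$ and $\operatorname{range}(V^T)=\operatorname{range}(U^TC^T)$; (4) put $L=-UMV^T(CUV^T)^{-1}$, where $(CUV^T)^{-1}$ is the inverse if $CU$ has full row rank (then $m=q$ and $CUV^T$ is invertible), and may be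 any left inverse of the $q\times m$ matrix $CUV^T$ in general. Then the construction can be carried out, and for all gains $K,L$ that it produces the following holds. (a) $A+(1-\sigma)LC$ is Schur stable for every $\sigma\in\mathbb C$ with $|\sigma|<1$. (b) If $A$ is not itself Schur stable, then the consensus region $\{\sigma\in\mathbb C : A+(1-\sigma)LC \text{ is Schur stable}\}$ is exactly the open unit disk. (c) For every $N$, every directed graph $\mathcal G$ on the nodes $1,\dots,N$ (with edges between distinct nodes) that contains a directed spanning tree (that is, some root has a directed path to every other node), and every row-stochastic matrix $(d_{ij})$ associated with $\mathcal G$ ($d_{ii}>0$; for $i\neq j$, $d_{ij}>0$ if $(j,i)$ is an edge and $d_{ij}=0$ otherwise; $\sum_j d_{ij}=1$), the agents $x_i(k+1)=Ax_i(k)+Bu_i(k)$, $y_i=Cx_i$, $i=1,\dots,N$, reach consensus under the protocol $$v_i(k+1)=(A+BK)v_i(k)+L\Big(\sum_{j=1}^N d_{ij}C(v_i(k)-v_j(k))-\sum_{j=1}^N d_{ij}(y_i(k)-y_j(k))\Big),\qquad u_i(k)=Kv_i(k):$$ for all initial states $x_i(0),v_i(0)$ and all $i,j$, $\|x_i(k)-x_j(k)\|\to0$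 as $k\to\infty$. -/

import Mathlib

open scoped Matrix Topology

namespace Consensus

/-- A complex matrix is Schur stable if all of its eigenvalues have magnitude less than `1`. -/
def SchurStable {n : ℕ} (A : Matrix (Fin n) (Fin n) ℂ) : Prop :=
  ∀ μ : ℂ, Module.End.HasEigenvalue (Matrix.toLin' A) μ → ‖μ‖ < 1

/-- A complex matrix is neutrally stable (in discrete time) if it has no eigenvalue of magnitude
larger than `1`, and all Jordan blocks of each eigenvalue of magnitude `1` have size one, that is,
every generalized eigenvector for such an eigenvalue is an eigenvector. -/
def NeutrallyStable {n : ℕ} (A : Matrix (Fin n) (Fin n) ℂ) : Prop :=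
  ∀ μ : ℂ, Module.End.HasEigenvalue (Matrix.toLin' A) μ →
    ‖μ‖ ≤ 1 ∧
      (‖μ‖ = 1 →
        Module.End.maxGenEigenspace (Matrix.toLin' A) μ =
          Module.End.eigenspace (Matrix.toLin' A) μ)

/-- A real matrix regarded as a complex one. -/
def complexify {m n : ℕ} (A : Matrix (Fin m) (Fin n) ℝ) : Matrix (Fin m) (Fin n) ℂ :=
  A.map (fun a : ℝ => (a : ℂ))

/-- `(A, B)` is stabilizable: some state feedback makes `A + B K` Schur stable. -/
def Stabilizable {n p : ℕ} (A : Matrix (Fin n) (Fin n) ℝ) (B : Matrix (Fin n) (Fin p) ℝ) : Prop :=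
  ∃ K : Matrix (Fin p) (Fin n) ℝ, SchurStable (complexify (A + B * K))

/-- `(A, C)` is detectable: some output injection makes `A + L C` Schur stable. -/
def Detectable {n q : ℕ} (A : Matrix (Fin n) (Fin n) ℝ) (C : Matrix (Fin q) (Fin n) ℝ) : Prop :=
  ∃ L : Matrix (Fin n) (Fin q) ℝ, SchurStable (complexify (A + L * C))

/-- `[U W]` is invertible and `[U W]⁻¹ A [U W] = diag(M, X)`, with `M` orthogonal and `X` Schur
stable. The invertibility forces `n₁ + n₂ = n`. -/
structure IsSplitting {n n₁ n₂ : ℕ} (A : Matrix (Fin n) (Fin n) ℝ)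
    (U : Matrix (Fin n) (Fin n₁) ℝ) (W : Matrix (Fin n) (Fin n₂) ℝ)
    (M : Matrix (Fin n₁) (Fin n₁) ℝ) (X : Matrix (Fin n₂) (Fin n₂) ℝ) : Prop where
  similar : ∃ T : Matrix (Fin n₁ ⊕ Fin n₂) (Fin n) ℝ,
    T * Matrix.fromCols U W = 1 ∧ Matrix.fromCols U W * T = 1 ∧
      T * A * Matrix.fromCols U W = Matrix.fromBlocks M 0 0 X
  orthogonal : M ∈ Matrix.orthogonalGroup (Fin n₁) ℝ
  schur : SchurStable (complexify X)

/-- The gains `K`, `L` are a possible outcome of the construction: `A + B K` is Schur stable, and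
`L = - U M Vᵀ (C U Vᵀ)⁻¹` for some splitting `U, W, M, X` of `A` and some `V` with `V Vᵀ = I` and
`range Vᵀ = range (Uᵀ Cᵀ)`.

Here `C U Vᵀ` is a `q × m` matrix and `m` is the rank of `C U`. If `C U` has full row rank then
`m = q`, the matrix is square, and `G` is its inverse. In general, `G` is any left inverse. -/
def IsDesign {n p q : ℕ} (A : Matrix (Fin n) (Fin n) ℝ) (B : Matrix (Fin n) (Fin p) ℝ)
    (C : Matrix (Fin q) (Fin n) ℝ) (K : Matrix (Fin p) (Fin n) ℝ)
    (L : Matrix (Fin n) (Fin q) ℝ) : Prop :=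
  SchurStable (complexify (A + B * K)) ∧
    ∃ (n₁ n₂ m : ℕ) (U : Matrix (Fin n) (Fin n₁) ℝ) (W : Matrix (Fin n) (Fin n₂) ℝ)
      (M : Matrix (Fin n₁) (Fin n₁) ℝ) (X : Matrix (Fin n₂) (Fin n₂) ℝ)
      (V : Matrix (Fin m) (Fin n₁) ℝ) (G : Matrix (Fin m) (Fin q) ℝ),
      IsSplitting A U W M X ∧
      V * Vᵀ = 1 ∧
      LinearMap.range Vᵀ.mulVecLin = LinearMap.range (Uᵀ * Cᵀ).mulVecLin ∧
      G * (C * U * Vᵀ) = 1 ∧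
      L = -(U * M * Vᵀ * G)

/-- The consensus region: all complex `σ` such that `A + (1 - σ) L C` is Schur stable. -/
def consensusRegion {n q : ℕ} (A : Matrix (Fin n) (Fin n) ℝ) (C : Matrix (Fin q) (Fin n) ℝ)
    (L : Matrix (Fin n) (Fin q) ℝ) : Set ℂ :=
  {σ | SchurStable (complexify A + (1 - σ) • complexify (L * C))}

/-- Directed graphs on `N` nodes (edges join distinct nodes) that contain a directed spanning
tree: from some root there is a directed path to every other node. -/
def spanningTreeGraphs (N : ℕ) : Set (Digraph (Fin N)) :=
  {G | (∀ i, ¬ G.Adj i i) ∧ ∃ root, ∀ j, Relation.ReflTransGen G.Adj root j}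

/-- `D` is a row-stochastic matrix associated with the directed graph `G`. An edge `(j, i)` means
that agent `i` receives information from agent `j`. -/
structure IsRowStochasticOf {N : ℕ} (G : Digraph (Fin N)) (D : Matrix (Fin N) (Fin N) ℝ) :
    Prop where
  diag_pos : ∀ i, 0 < D i i
  edge_pos : ∀ i j, G.Adj j i → 0 < D i j
  nonedge : ∀ i j, i ≠ j → ¬ G.Adj j i → D i j = 0
  row_sum : ∀ i, ∑ j, D i j = 1

/-- The relative measurement `∑ⱼ dᵢⱼ (yᵢ - yⱼ)` available to agent `i`, where `yⱼ = C xⱼ`. -/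
def relMeasurement {N n q : ℕ} (C : Matrix (Fin q) (Fin n) ℝ) (D : Matrix (Fin N) (Fin N) ℝ)
    (x : Fin N → Fin n → ℝ) (i : Fin N) : Fin q → ℝ :=
  ∑ j, D i j • (C *ᵥ x i - C *ᵥ x j)

/-- `x` (agent states) and `v` (protocol states) evolve according to the agent dynamics
`xᵢ⁺ = A xᵢ + B uᵢ`, `yᵢ = C xᵢ`, under the observer-type protocol
`vᵢ⁺ = (A + B K) vᵢ + L (∑ⱼ dᵢⱼ C (vᵢ - vⱼ) - ζᵢ)`, `uᵢ = K vᵢ`, with `ζᵢ = ∑ⱼ dᵢⱼ (yᵢ - yⱼ)`. -/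
structure IsClosedLoop {N n p q : ℕ} (A : Matrix (Fin n) (Fin n) ℝ)
    (B : Matrix (Fin n) (Fin p) ℝ) (C : Matrix (Fin q) (Fin n) ℝ)
    (K : Matrix (Fin p) (Fin n) ℝ) (L : Matrix (Fin n) (Fin q) ℝ)
    (D : Matrix (Fin N) (Fin N) ℝ) (x v : ℕ → Fin N → Fin n → ℝ) : Prop where
  agent : ∀ k i, x (k + 1) i = A *ᵥ x k i + B *ᵥ (K *ᵥ v k i)
  protocol : ∀ k i, v (k + 1) i = (A + B * K) *ᵥ v k i +
    L *ᵥ ((∑ j, D i j • (C *ᵥ (v k i - v k j))) - relMeasurement C D (x k) i)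

/-- The protocol with gains `K`, `L` solves the consensus problem over `D`: for all initial states,
`‖xᵢ(k) - xⱼ(k)‖ → 0` (Euclidean norm) for all `i, j`. -/
def SolvesConsensus {N n p q : ℕ} (A : Matrix (Fin n) (Fin n) ℝ)
    (B : Matrix (Fin n) (Fin p) ℝ) (C : Matrix (Fin q) (Fin n) ℝ)
    (K : Matrix (Fin p) (Fin n) ℝ) (L : Matrix (Fin n) (Fin q) ℝ)
    (D : Matrix (Fin N) (Fin N) ℝ) : Prop :=
  ∀ x v : ℕ → Fin N → Fin n → ℝ, IsClosedLoop A B C K L D x v →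
    ∀ i j, Filter.Tendsto (fun k => ‖WithLp.toLp 2 (x k i - x k j)‖) Filter.atTop (𝓝 0)

end Consensus

/-!
Write `P = VᵀV` for the orthogonal projection onto the row space of `C U`. Since `C U = C U P`, the
gain `L` satisfies `L C U = -U M P`, so in the basis `[U W]` the matrix `A + (1 - σ) L C` is block
triangular with diagonal blocks `M (I - (1 - σ) P)` and `X`. As `M` is orthogonal,
`‖M (I - (1 - σ) P) z‖² = ‖z‖² - (1 - |σ|²) ‖V z‖²` (`normSq_reduced_eigenvector`). For `|σ| < 1` an
eigenvalue of modulus at least `1` forces `V z = 0`, hence `C U z = 0` and `A U z = μ U z`, which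
contradicts detectability (`schurStable_of_norm_lt_one`). For `|σ| ≥ 1` the norm does not decrease,
so no eigenvalue of the first block lies in the open disk (`not_schurStable_of_one_le_norm`).

For consensus, the errors `vᵢ - xᵢ` evolve under `I ⊗ A + (I - D) ⊗ L C`, which commutes with
`D ⊗ I` and preserves the subspace of agreement. Modulo that subspace the two maps have common
eigenvectors, for any prescribed eigenvalue `μ` of the first; the eigenvalue `σ` of `D` satisfies
`|σ| < 1` by a maximum principle on the graph (`eq_of_stochastic_eigenvector_mod_const`), so `μ` is
an eigenvalue of `A + (1 - σ) L C` and has modulus less than `1`. Together with the stability of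
`A + B K` this makes the joint dynamics of `(v - x, v)` stable modulo agreement of the errors
(`tendsto_closedLoopMap`), and the differences `xᵢ - xⱼ` vanish on that subspace.

The construction can be carried out because a neutrally stable `A` splits `ℂⁿ` into the span of the
eigenvectors on the unit circle and the vectors with decaying orbits. Both are invariant under
complex conjugation, so the splitting descends to `ℝⁿ` (`isCompl_realPoints`). The first part
carries an `A`-invariant inner product (`exists_invariant_inner`), and in an orthonormal basis for
it `A` becomes an orthogonal matrix. An orthonormal basis of the row space of `C U` gives `V`.
-/

open scoped Matrix Topology

namespace Consensus

open Filter

/-! ### Decaying orbits and eigenvectors modulo an invariant subspace -/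

theorem tendsto_zero_of_forced_recursion {z y : ℕ → ℂ} {μ : ℂ} (hμ : ‖μ‖ < 1)
    (hz : ∀ k, z (k + 1) = μ * z k + y k) (hy : Tendsto y atTop (𝓝 0)) :
    Tendsto z atTop (𝓝 0) := by
  rw [Metric.tendsto_atTop] at hy ⊢
  intro ε hε
  have hr : 0 < 1 - ‖μ‖ := by linarith
  -- an input of size `ε / 2 * (1 - ‖μ‖)` contributes at most `ε / 2` after geometric summation
  obtain ⟨K, hK⟩ := hy (ε / 2 * (1 - ‖μ‖)) (by positivity)
  have hbound : ∀ j, ‖z (K + j)‖ ≤ ‖μ‖ ^ j * ‖z K‖ + ε / 2 := by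
    intro j
    induction j with
    | zero => simp; positivity
    | succ j ih =>
      have h1 : ‖y (K + j)‖ ≤ ε / 2 * (1 - ‖μ‖) := by
        simpa using (hK (K + j) (by omega)).le
      calc ‖z (K + (j + 1))‖ = ‖μ * z (K + j) + y (K + j)‖ := by rw [← add_assoc, hz]
        _ ≤ ‖μ‖ * ‖z (K + j)‖ + ‖y (K + j)‖ := by
          rw [← norm_mul]; exact norm_add_le _ _
        _ ≤ ‖μ‖ * (‖μ‖ ^ j * ‖z K‖ + ε / 2) + ε / 2 * (1 - ‖μ‖) := by gcongr
        _ = ‖μ‖ ^ (j + 1) * ‖z K‖ + ε / 2 := by ring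
  have hpow : Tendsto (fun j => ‖μ‖ ^ j * ‖z K‖) atTop (𝓝 0) := by
    simpa using (tendsto_pow_atTop_nhds_zero_of_lt_one (norm_nonneg μ) hμ).mul_const ‖z K‖
  obtain ⟨J, hJ⟩ := eventually_atTop.1 (hpow.eventually (gt_mem_nhds (half_pos hε)))
  refine ⟨K + J, fun k hk => ?_⟩
  obtain ⟨j, rfl⟩ := Nat.exists_eq_add_of_le (show K ≤ k by omega)
  rw [dist_zero_right]
  linarith [hbound j, hJ j (by omega)]

section Decaying

variable {V : Type*} [AddCommGroup V] [Module ℂ V]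

/-- The vectors whose orbit under `f` tends to zero. Convergence is tested on linear functionals,
so that no topology on `V` is needed, in particular none on quotients. -/
def decaying (f : Module.End ℂ V) : Submodule ℂ V where
  carrier := {x | ∀ φ : Module.Dual ℂ V, Tendsto (fun k => φ ((f ^ k) x)) atTop (𝓝 0)}
  add_mem' hx hy φ := by simpa using (hx φ).add (hy φ)
  zero_mem' φ := by simp
  smul_mem' c x hx φ := by simpa using (hx φ).const_mul c

theorem map_mem_decaying {f : Module.End ℂ V} {x : V} (hx : x ∈ decaying f) :
    f x ∈ decaying f := fun φ => by
  simpa [pow_succ] using (tendsto_add_atTop_iff_nat 1).2 (hx φ)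

theorem maxGenEigenspace_le_decaying (f : Module.End ℂ V) {μ : ℂ} (hμ : ‖μ‖ < 1) :
    f.maxGenEigenspace μ ≤ decaying f := by
  intro x hx
  obtain ⟨m, hm⟩ := (Module.End.mem_maxGenEigenspace f μ x).1 hx
  clear hx
  induction m generalizing x with
  | zero =>
    obtain rfl : x = 0 := by simpa using hm
    exact zero_mem _
  | succ m ih =>
    -- `f x = μ x + y` with `y` of lower order, so `φ (f ^ k x)` is driven by `φ (f ^ k y) → 0`
    have hy := ih (x := (f - μ • 1) x) (by simpa [pow_succ] using hm)
    refine fun φ => tendsto_zero_of_forced_recursion hμ (fun k => ?_) (hy φ)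
    simp [pow_succ]

theorem eq_top_of_maxGenEigenspace_le [FiniteDimensional ℂ V] {f : Module.End ℂ V}
    {S : Submodule ℂ V} (h : ∀ μ, f.HasEigenvalue μ → f.maxGenEigenspace μ ≤ S) : S = ⊤ := by
  rw [eq_top_iff, ← Module.End.iSup_maxGenEigenspace_eq_top f]
  refine iSup_le fun μ => ?_
  by_cases hμ : f.HasEigenvalue μ
  · exact h μ hμ
  · have : f.maxGenEigenspace μ = ⊥ := by
      by_contra h'
      exact hμ (Module.End.HasUnifEigenvalue.lt zero_lt_one h')
    simp [this]

theorem decaying_eq_top [FiniteDimensional ℂ V] {f : Module.End ℂ V}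
    (hf : ∀ μ, f.HasEigenvalue μ → ‖μ‖ < 1) : decaying f = ⊤ :=
  eq_top_of_maxGenEigenspace_le fun μ hμ => maxGenEigenspace_le_decaying f (hf μ hμ)

/-- If every eigenvalue of the map induced by `f` on `V ⧸ S` has modulus less than `1`, then every
functional that vanishes on `S` decays along the orbits of `f`. -/
theorem tendsto_functional_of_eigenvalues_mod [FiniteDimensional ℂ V] {f : Module.End ℂ V}
    {S : Submodule ℂ V} (hS : S ≤ S.comap f)
    (hf : ∀ (μ : ℂ) (x : V), x ∉ S → f x - μ • x ∈ S → ‖μ‖ < 1)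
    {φ : Module.Dual ℂ V} (hφ : S ≤ LinearMap.ker φ) (x : V) :
    Tendsto (fun k => φ ((f ^ k) x)) atTop (𝓝 0) := by
  have htop : decaying (S.mapQ S f hS) = ⊤ := by
    refine decaying_eq_top fun μ hμ => ?_
    obtain ⟨y, hy⟩ := hμ.exists_hasEigenvector
    obtain ⟨y, rfl⟩ := S.mkQ_surjective y
    refine hf μ y (fun h => hy.2 (by simpa using h)) ?_
    have := hy.apply_eq_smul
    rw [← Submodule.Quotient.mk_eq_zero, Submodule.Quotient.mk_sub, sub_eq_zero]
    simpa using this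
  have h : S.mkQ x ∈ decaying (S.mapQ S f hS) := htop ▸ Submodule.mem_top
  have hpow : ∀ k, ((S.mapQ S f hS) ^ k) (S.mkQ x) = S.mkQ ((f ^ k) x) := by
    intro k
    induction k with
    | zero => simp
    | succ k ih => rw [pow_succ', pow_succ', Module.End.mul_apply, ih]; simp
  have hlim := h (S.liftQ φ hφ)
  simp only [hpow] at hlim
  exact hlim

/-- Commuting maps have a common eigenvector modulo a common invariant subspace `S`, and the
eigenvalue of the first of them can be prescribed. -/
theorem exists_common_eigenvector_mod [FiniteDimensional ℂ V] {f g : Module.End ℂ V}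
    (hfg : ∀ x, f (g x) = g (f x)) {S : Submodule ℂ V} (hfS : ∀ x ∈ S, f x ∈ S)
    (hgS : ∀ x ∈ S, g x ∈ S) {μ : ℂ} {x : V} (hx : x ∉ S) (hfx : f x - μ • x ∈ S) :
    ∃ (y : V) (σ : ℂ), y ∉ S ∧ f y - μ • y ∈ S ∧ g y - σ • y ∈ S := by
  -- on `V ⧸ S` the second map preserves the eigenspace of the first, so it has an eigenvector there
  let F : Module.End ℂ (V ⧸ S) := S.mapQ S f hfS
  let G : Module.End ℂ (V ⧸ S) := S.mapQ S g hgS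
  have hmk : ∀ (h : Module.End ℂ V) (hh : ∀ x ∈ S, h x ∈ S) (ν : ℂ) (y : V),
      S.mapQ S h hh (S.mkQ y) = ν • S.mkQ y ↔ h y - ν • y ∈ S := by
    intro h hh ν y
    rw [← Submodule.Quotient.mk_eq_zero, Submodule.Quotient.mk_sub, sub_eq_zero]
    simp
  have hmap : ∀ y ∈ F.eigenspace μ, G y ∈ F.eigenspace μ := by
    intro y hy
    obtain ⟨y, rfl⟩ := S.mkQ_surjective y
    rw [Module.End.mem_eigenspace_iff] at hy ⊢
    have : F (G (S.mkQ y)) = G (F (S.mkQ y)) := by simp [F, G, hfg]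
    rw [this, hy, map_smul]
  have hne : (⟨S.mkQ x, Module.End.mem_eigenspace_iff.2 ((hmk f hfS μ x).2 hfx)⟩ :
      F.eigenspace μ) ≠ 0 := by
    simpa [Subtype.ext_iff] using hx
  have : Nontrivial (F.eigenspace μ) := ⟨_, _, hne⟩
  obtain ⟨σ, hσ⟩ := Module.End.exists_eigenvalue (G.restrict hmap)
  obtain ⟨⟨y, hyF⟩, hy⟩ := hσ.exists_hasEigenvector
  obtain ⟨y, rfl⟩ := S.mkQ_surjective y
  refine ⟨y, σ, fun h => hy.2 ?_, (hmk f hfS μ y).1 (Module.End.mem_eigenspace_iff.1 hyF),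
    (hmk g hgS σ y).1 ?_⟩
  · simpa [Subtype.ext_iff] using h
  · exact congrArg Subtype.val hy.apply_eq_smul

end Decaying

/-! ### Row-stochastic matrices of graphs with a spanning tree -/

/-- Maximum principle: if `D w = σ w + c` with `|σ| ≥ 1`, then `w` is constant. The differences
`w i - w j` are transformed by averaging over pairs, so a pair at maximal distance `d` stays maximal
when one of its members is replaced by an in-neighbour (the other stays fixed since `D` has a
positive diagonal). Moving both members to the root gives `d = 0`. -/
theorem eq_of_stochastic_eigenvector_mod_const {N : ℕ} {G : Digraph (Fin N)}
    {D : Matrix (Fin N) (Fin N) ℝ} (hD : IsRowStochasticOf G D) {root : Fin N}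
    (hroot : ∀ j, Relation.ReflTransGen G.Adj root j) {w : Fin N → ℂ} {σ c : ℂ}
    (hw : ∀ i, ∑ j, (D i j : ℂ) * w j = σ * w i + c) (hσ : 1 ≤ ‖σ‖) (i j : Fin N) :
    w i = w j := by
  have : Nonempty (Fin N × Fin N) := ⟨(i, j)⟩
  obtain ⟨⟨a, b⟩, hab⟩ := Finite.exists_max fun e : Fin N × Fin N => ‖w e.1 - w e.2‖
  set d := ‖w a - w b‖ with hd
  have hmax : ∀ k l, ‖w k - w l‖ ≤ d := fun k l => hab (k, l)
  have hnonneg : ∀ k l, 0 ≤ D k l := by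
    intro k l
    by_cases hkl : k = l
    · exact hkl ▸ (hD.diag_pos k).le
    · by_cases h : G.Adj l k
      · exact (hD.edge_pos k l h).le
      · exact (hD.nonedge k l hkl h).ge
  have hstep : ∀ k l m, D k m ≠ 0 → ‖w k - w l‖ = d → ‖w m - w l‖ = d := by
    intro k l m hkm hkl
    by_contra hne
    have hlt : ‖w m - w l‖ < d := lt_of_le_of_ne (hmax m l) hne
    have hsumC : ∀ s, ∑ t, (D s t : ℂ) = 1 := fun s => by
      exact_mod_cast hD.row_sum s
    have hexp : σ * (w k - w l) =
        ∑ e : Fin N × Fin N, ((D k e.1 * D l e.2 : ℝ) : ℂ) * (w e.1 - w e.2) := by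
      rw [Fintype.sum_prod_type]
      have h1 : ∀ s t, ((D k s * D l t : ℝ) : ℂ) * (w s - w t) =
          (D k s * w s) * D l t - D k s * (D l t * w t) := by
        intro s t; push_cast; ring
      simp only [h1, Finset.sum_sub_distrib, ← Finset.mul_sum, ← Finset.sum_mul, hsumC, hw]
      ring
    have hsum : ∑ e : Fin N × Fin N, D k e.1 * D l e.2 * d = d := by
      rw [Fintype.sum_prod_type]
      simp only [← Finset.mul_sum, ← Finset.sum_mul, hD.row_sum]
      ring
    have : d < d := calc
      d = ‖w k - w l‖ := hkl.symm
      _ ≤ ‖σ‖ * ‖w k - w l‖ := le_mul_of_one_le_left (norm_nonneg _) hσ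
      _ = ‖∑ e : Fin N × Fin N, ((D k e.1 * D l e.2 : ℝ) : ℂ) * (w e.1 - w e.2)‖ := by
        rw [← norm_mul, hexp]
      _ ≤ ∑ e : Fin N × Fin N, D k e.1 * D l e.2 * ‖w e.1 - w e.2‖ := by
        refine (norm_sum_le _ _).trans (Finset.sum_le_sum fun e _ => ?_)
        rw [norm_mul, Complex.norm_real, Real.norm_of_nonneg
          (mul_nonneg (hnonneg _ _) (hnonneg _ _))]
      _ < ∑ e : Fin N × Fin N, D k e.1 * D l e.2 * d := by
        refine Finset.sum_lt_sum (fun e _ => ?_) ⟨(m, l), Finset.mem_univ _, ?_⟩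
        · exact mul_le_mul_of_nonneg_left (hmax _ _) (mul_nonneg (hnonneg _ _) (hnonneg _ _))
        · exact mul_lt_mul_of_pos_left hlt
            (mul_pos (lt_of_le_of_ne (hnonneg k m) hkm.symm) (hD.diag_pos l))
      _ = d := hsum
    exact this.false
  have hback : ∀ k l, ‖w k - w l‖ = d → ‖w root - w l‖ = d := by
    intro k l
    induction hroot k with
    | refl => exact id
    | tail _ hadj ih => exact fun h => ih (hstep _ l _ (hD.edge_pos _ _ hadj).ne' h)
  have h0 : d = 0 := by
    have h1 := hback a b hd.symm
    have h2 := hback b root (by rw [norm_sub_rev]; exact h1)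
    simpa using h2.symm
  exact sub_eq_zero.1 (norm_le_zero_iff.1 (h0 ▸ hmax i j))

/-! ### Complexified matrices and the Euclidean norm -/

theorem schurStable_iff {n : ℕ} {A : Matrix (Fin n) (Fin n) ℂ} : SchurStable A ↔
    ∀ (μ : ℂ) (z : Fin n → ℂ), z ≠ 0 → A *ᵥ z = μ • z → ‖μ‖ < 1 := by
  constructor
  · intro h μ z hz hAz
    exact h μ (Module.End.hasEigenvalue_of_hasEigenvector
      ⟨Module.End.mem_eigenspace_iff.2 (by simpa using hAz), hz⟩)
  · intro h μ hμ
    obtain ⟨z, hz⟩ := hμ.exists_hasEigenvector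
    exact h μ z hz.2 (by simpa using hz.apply_eq_smul)

section Complexify

variable {l m n : ℕ}

theorem complexify_mul (A : Matrix (Fin l) (Fin m) ℝ) (B : Matrix (Fin m) (Fin n) ℝ) :
    complexify (A * B) = complexify A * complexify B :=
  Matrix.map_mul (f := Complex.ofRealHom)

theorem complexify_add (A B : Matrix (Fin m) (Fin n) ℝ) :
    complexify (A + B) = complexify A + complexify B := by
  ext; simp [complexify]

theorem complexify_neg (A : Matrix (Fin m) (Fin n) ℝ) :
    complexify (-A) = -complexify A := by
  ext; simp [complexify]

theorem complexify_one : complexify (1 : Matrix (Fin n) (Fin n) ℝ) = 1 := by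
  simp [complexify, Matrix.map_one]

theorem complexify_zero : complexify (0 : Matrix (Fin m) (Fin n) ℝ) = 0 := by
  ext; simp [complexify]

theorem complexify_transpose (A : Matrix (Fin m) (Fin n) ℝ) :
    complexify Aᵀ = (complexify A)ᴴ := by
  ext; simp [complexify]

theorem complexify_mulVec (A : Matrix (Fin m) (Fin n) ℝ) (x : Fin n → ℝ) :
    complexify A *ᵥ (fun j => (x j : ℂ)) = fun i => ((A *ᵥ x) i : ℂ) := by
  ext; simp [complexify, Matrix.mulVec, dotProduct]

end Complexify

section Norm

variable {m n : ℕ}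

/-- The squared Euclidean norm of a complex vector; the norm of `Fin n → ℂ` itself is the
sup norm. -/
noncomputable def normSq (z : Fin n → ℂ) : ℝ := ∑ i, ‖z i‖ ^ 2

theorem normSq_nonneg (z : Fin n → ℂ) : 0 ≤ normSq z :=
  Finset.sum_nonneg fun _ _ => sq_nonneg _

theorem normSq_eq_zero {z : Fin n → ℂ} : normSq z = 0 ↔ z = 0 := by
  rw [normSq, Finset.sum_eq_zero_iff_of_nonneg fun _ _ => sq_nonneg _]
  simp [funext_iff]

theorem normSq_pos {z : Fin n → ℂ} (hz : z ≠ 0) : 0 < normSq z :=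
  lt_of_le_of_ne (normSq_nonneg z) fun h => hz (normSq_eq_zero.1 h.symm)

theorem normSq_smul (μ : ℂ) (z : Fin n → ℂ) : normSq (μ • z) = ‖μ‖ ^ 2 * normSq z := by
  simp [normSq, Finset.mul_sum, mul_pow]

theorem ofReal_normSq (z : Fin n → ℂ) : (normSq z : ℂ) = star z ⬝ᵥ z := by
  simp [normSq, dotProduct, Complex.conj_mul']

theorem normSq_mulVec_of_conjTranspose_mul_self {Q : Matrix (Fin m) (Fin n) ℂ} (hQ : Qᴴ * Q = 1)
    (z : Fin n → ℂ) : normSq (Q *ᵥ z) = normSq z := by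
  have h : (normSq (Q *ᵥ z) : ℂ) = normSq z := by
    rw [ofReal_normSq, ofReal_normSq, Matrix.star_mulVec, ← Matrix.dotProduct_mulVec,
      Matrix.mulVec_mulVec, hQ, Matrix.one_mulVec]
  exact_mod_cast h

/-- `I - (1 - σ) VᴴV` multiplies the range of the projection `VᴴV` by `σ` and fixes its orthogonal
complement. -/
theorem normSq_sub_smul_projection {V : Matrix (Fin m) (Fin n) ℂ} (hV : V * Vᴴ = 1) (σ : ℂ)
    (z : Fin n → ℂ) :
    normSq (z - (1 - σ) • (Vᴴ *ᵥ (V *ᵥ z))) =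
      normSq z - (1 - ‖σ‖ ^ 2) * normSq (V *ᵥ z) := by
  set u := V *ᵥ z with hu
  have h1 : star z ⬝ᵥ (Vᴴ *ᵥ u) = star u ⬝ᵥ u := by
    rw [Matrix.dotProduct_mulVec, hu, Matrix.star_mulVec]
  have h2 : star (Vᴴ *ᵥ u) ⬝ᵥ z = star u ⬝ᵥ u := by
    rw [Matrix.star_mulVec, Matrix.conjTranspose_conjTranspose, ← Matrix.dotProduct_mulVec]
  have h3 : star (Vᴴ *ᵥ u) ⬝ᵥ (Vᴴ *ᵥ u) = star u ⬝ᵥ u := by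
    rw [Matrix.star_mulVec, Matrix.conjTranspose_conjTranspose, ← Matrix.dotProduct_mulVec,
      Matrix.mulVec_mulVec, hV, Matrix.one_mulVec]
  have h : (normSq (z - (1 - σ) • (Vᴴ *ᵥ u)) : ℂ) =
      ((normSq z - (1 - ‖σ‖ ^ 2) * normSq u : ℝ) : ℂ) := by
    push_cast
    rw [← Complex.conj_mul' σ]
    simp only [ofReal_normSq, star_sub, star_smul, sub_dotProduct, dotProduct_sub,
      smul_dotProduct, dotProduct_smul, h1, h2, h3, smul_eq_mul, Complex.star_def, map_one]
    ring
  exact_mod_cast h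

end Norm

/-! ### The consensus region -/

section Design

variable {n n₁ n₂ m q : ℕ} {A : Matrix (Fin n) (Fin n) ℝ}
  {U : Matrix (Fin n) (Fin n₁) ℝ} {W : Matrix (Fin n) (Fin n₂) ℝ}
  {M : Matrix (Fin n₁) (Fin n₁) ℝ} {X : Matrix (Fin n₂) (Fin n₂) ℝ}
  {V : Matrix (Fin m) (Fin n₁) ℝ} {G : Matrix (Fin m) (Fin q) ℝ} {C : Matrix (Fin q) (Fin n) ℝ}

/-- The block rows `T₁`, `T₂` of `[U W]⁻¹`, with the relations among the blocks. -/
theorem IsSplitting.exists_blocks (h : IsSplitting A U W M X) :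
    ∃ (T₁ : Matrix (Fin n₁) (Fin n) ℝ) (T₂ : Matrix (Fin n₂) (Fin n) ℝ),
      T₁ * U = 1 ∧ T₂ * U = 0 ∧ U * T₁ + W * T₂ = 1 ∧ T₂ * A = X * T₂ ∧ A * U = U * M := by
  obtain ⟨T, hT1, hT2, hT3⟩ := h.similar
  obtain ⟨T₁, T₂, rfl⟩ : ∃ T₁ T₂, T = Matrix.fromRows T₁ T₂ :=
    ⟨_, _, (Matrix.fromRows_toRows T).symm⟩
  have h4 : Matrix.fromRows T₁ T₂ * A = Matrix.fromBlocks M 0 0 X * Matrix.fromRows T₁ T₂ := by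
    rw [← hT3, Matrix.mul_assoc, hT2, Matrix.mul_one]
  have h5 : A * Matrix.fromCols U W = Matrix.fromCols U W * Matrix.fromBlocks M 0 0 X := by
    rw [← hT3, Matrix.mul_assoc, ← Matrix.mul_assoc, hT2, Matrix.one_mul]
  rw [Matrix.fromRows_mul_fromCols, ← Matrix.fromBlocks_one, Matrix.fromBlocks_inj] at hT1
  rw [Matrix.fromCols_mul_fromRows] at hT2
  rw [Matrix.fromRows_mul, Matrix.fromBlocks_mul_fromRows, Matrix.fromRows_inj.eq_iff] at h4
  rw [Matrix.mul_fromCols, Matrix.fromCols_mul_fromBlocks, Matrix.fromCols_inj.eq_iff] at h5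
  refine ⟨T₁, T₂, hT1.1, hT1.2.2.1, hT2, ?_, ?_⟩
  · simpa using h4.2
  · simpa using h5.1

theorem mul_transpose_mul_self_of_range_eq {E : Matrix (Fin q) (Fin n₁) ℝ} (hV : V * Vᵀ = 1)
    (hr : LinearMap.range Vᵀ.mulVecLin = LinearMap.range Eᵀ.mulVecLin) : E * (Vᵀ * V) = E := by
  apply Matrix.transpose_injective
  apply Matrix.ext_of_mulVec_single
  intro i
  obtain ⟨u, hu⟩ : Eᵀ *ᵥ Pi.single i 1 ∈ LinearMap.range Vᵀ.mulVecLin :=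
    hr ▸ ⟨Pi.single i 1, rfl⟩
  rw [Matrix.mulVecLin_apply] at hu
  rw [Matrix.transpose_mul, Matrix.transpose_mul, Matrix.transpose_transpose,
    ← Matrix.mulVec_mulVec, ← hu, Matrix.mulVec_mulVec, Matrix.mul_assoc, hV, Matrix.mul_one]

/-- The perturbed matrix preserves the range of `U`, because `G C U = G C U VᵀV = V`. -/
theorem perturbed_mulVec_range (h : IsSplitting A U W M X) (hV : V * Vᵀ = 1)
    (hr : LinearMap.range Vᵀ.mulVecLin = LinearMap.range (Uᵀ * Cᵀ).mulVecLin)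
    (hG : G * (C * U * Vᵀ) = 1) (σ : ℂ) (z : Fin n₁ → ℂ) :
    (complexify A + (1 - σ) • complexify (-(U * M * Vᵀ * G) * C)) *ᵥ (complexify U *ᵥ z) =
      complexify U *ᵥ (complexify M *ᵥ
        (z - (1 - σ) • (complexify Vᵀ *ᵥ (complexify V *ᵥ z)))) := by
  obtain ⟨-, -, -, -, -, -, hAU⟩ := h.exists_blocks
  have hE : C * U * (Vᵀ * V) = C * U :=
    mul_transpose_mul_self_of_range_eq hV (by rwa [Matrix.transpose_mul])
  have hGCU : G * (C * U) = V := by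
    rw [← hE, ← Matrix.mul_assoc (C * U), ← Matrix.mul_assoc G, hG, Matrix.one_mul]
  rw [Matrix.mulVec_mulVec, Matrix.add_mul, Matrix.smul_mul, ← complexify_mul, ← complexify_mul,
    hAU, Matrix.neg_mul, Matrix.neg_mul, Matrix.mul_assoc _ C, Matrix.mul_assoc _ G, hGCU]
  simp only [complexify_neg, complexify_mul, smul_neg, ← sub_eq_add_neg]
  simp only [Matrix.sub_mulVec, Matrix.smul_mulVec, Matrix.mulVec_sub, Matrix.mulVec_smul,
    ← Matrix.mulVec_mulVec]

theorem IsSplitting.mulVec_injective (h : IsSplitting A U W M X) :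
    Function.Injective fun z => complexify U *ᵥ z := by
  obtain ⟨T₁, -, hTU, -⟩ := h.exists_blocks
  refine Function.LeftInverse.injective (g := fun y => complexify T₁ *ᵥ y) fun z => ?_
  change complexify T₁ *ᵥ (complexify U *ᵥ z) = z
  rw [Matrix.mulVec_mulVec, ← complexify_mul, hTU, complexify_one, Matrix.one_mulVec]

/-- An eigenvector of `A + (1 - σ) L C` for an eigenvalue outside the open unit disk has no
component in the Schur stable part, since `L` maps into the range of `U`. -/
theorem exists_reduced_eigenvector (h : IsSplitting A U W M X) (hV : V * Vᵀ = 1)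
    (hr : LinearMap.range Vᵀ.mulVecLin = LinearMap.range (Uᵀ * Cᵀ).mulVecLin)
    (hG : G * (C * U * Vᵀ) = 1) {σ μ : ℂ} {y : Fin n → ℂ} (hy : y ≠ 0) (hμ : 1 ≤ ‖μ‖)
    (hev : (complexify A + (1 - σ) • complexify (-(U * M * Vᵀ * G) * C)) *ᵥ y = μ • y) :
    ∃ z, z ≠ 0 ∧ y = complexify U *ᵥ z ∧
      complexify M *ᵥ (z - (1 - σ) • (complexify Vᵀ *ᵥ (complexify V *ᵥ z))) = μ • z := by
  obtain ⟨T₁, T₂, -, hTU₂, hT, hTA, -⟩ := h.exists_blocks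
  set L := -(U * M * Vᵀ * G) with hL
  have hT₂L : T₂ * (L * C) = 0 := by
    simp only [hL, Matrix.neg_mul, Matrix.mul_neg, ← Matrix.mul_assoc, hTU₂, Matrix.zero_mul,
      neg_zero]
  have hT₂y : complexify T₂ *ᵥ y = 0 := by
    by_contra hne
    have := schurStable_iff.1 h.schur μ _ hne (by
      rw [Matrix.mulVec_mulVec, ← complexify_mul, ← hTA, complexify_mul, ← Matrix.mulVec_smul,
        ← hev, Matrix.mulVec_mulVec, Matrix.mul_add, Matrix.mul_smul, ← complexify_mul T₂ (L * C),
        hT₂L, complexify_zero, smul_zero, add_zero])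
    linarith
  have hyU : y = complexify U *ᵥ (complexify T₁ *ᵥ y) := by
    have := congrArg (fun Q => complexify Q *ᵥ y) hT
    simpa [complexify_add, complexify_mul, complexify_one, Matrix.add_mulVec,
      ← Matrix.mulVec_mulVec, hT₂y] using this.symm
  refine ⟨complexify T₁ *ᵥ y, fun h0 => hy (by rw [hyU, h0, Matrix.mulVec_zero]), hyU, ?_⟩
  apply h.mulVec_injective
  change complexify U *ᵥ _ = complexify U *ᵥ _
  rw [← perturbed_mulVec_range h hV hr hG, Matrix.mulVec_smul, ← hyU, ← hL, hev]

theorem normSq_reduced_eigenvector (hM : M ∈ Matrix.orthogonalGroup (Fin n₁) ℝ)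
    (hV : V * Vᵀ = 1) {σ μ : ℂ} {z : Fin n₁ → ℂ}
    (hz : complexify M *ᵥ (z - (1 - σ) • (complexify Vᵀ *ᵥ (complexify V *ᵥ z))) = μ • z) :
    ‖μ‖ ^ 2 * normSq z = normSq z - (1 - ‖σ‖ ^ 2) * normSq (complexify V *ᵥ z) := by
  have hM' : (complexify M)ᴴ * complexify M = 1 := by
    rw [← complexify_transpose, ← complexify_mul, ← complexify_one]
    exact congrArg complexify ((Matrix.mem_orthogonalGroup_iff' _ _).1 hM)
  have hV' : complexify V * (complexify V)ᴴ = 1 := by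
    rw [← complexify_transpose, ← complexify_mul, hV, complexify_one]
  rw [← normSq_smul, ← hz, normSq_mulVec_of_conjTranspose_mul_self hM', complexify_transpose,
    normSq_sub_smul_projection hV']

/-- An eigenvector outside the open unit disk would have `V z = 0`, hence `C U z = 0`, and would
give an eigenvector of `A` that no output injection can move. -/
theorem schurStable_of_norm_lt_one (hAC : Detectable A C) (h : IsSplitting A U W M X)
    (hV : V * Vᵀ = 1)
    (hr : LinearMap.range Vᵀ.mulVecLin = LinearMap.range (Uᵀ * Cᵀ).mulVecLin)
    (hG : G * (C * U * Vᵀ) = 1) {σ : ℂ} (hσ : ‖σ‖ < 1) :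
    SchurStable (complexify A + (1 - σ) • complexify (-(U * M * Vᵀ * G) * C)) := by
  rw [schurStable_iff]
  intro μ y hy hev
  by_contra! hμ
  obtain ⟨z, hz, rfl, hMz⟩ := exists_reduced_eigenvector h hV hr hG hy hμ hev
  have hnorm := normSq_reduced_eigenvector h.orthogonal hV hMz
  have hVz : complexify V *ᵥ z = 0 := by
    have h1 : 0 < 1 - ‖σ‖ ^ 2 := by nlinarith [norm_nonneg σ]
    have h2 : normSq z ≤ ‖μ‖ ^ 2 * normSq z :=
      le_mul_of_one_le_left (normSq_nonneg z) (one_le_pow₀ hμ)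
    have h3 := normSq_nonneg (complexify V *ᵥ z)
    exact normSq_eq_zero.1 (by nlinarith)
  have hE : C * U * (Vᵀ * V) = C * U :=
    mul_transpose_mul_self_of_range_eq hV (by rwa [Matrix.transpose_mul])
  have hCz : complexify C *ᵥ (complexify U *ᵥ z) = 0 := by
    rw [Matrix.mulVec_mulVec, ← complexify_mul, ← hE, ← Matrix.mul_assoc, complexify_mul _ V,
      ← Matrix.mulVec_mulVec, hVz, Matrix.mulVec_zero]
  obtain ⟨-, -, -, -, -, -, hAU⟩ := h.exists_blocks
  have hAz : complexify A *ᵥ (complexify U *ᵥ z) = μ • (complexify U *ᵥ z) := by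
    rw [hVz, Matrix.mulVec_zero, smul_zero, sub_zero] at hMz
    rw [Matrix.mulVec_mulVec, ← complexify_mul, hAU, complexify_mul, ← Matrix.mulVec_mulVec, hMz,
      Matrix.mulVec_smul]
  obtain ⟨L, hL⟩ := hAC
  have := schurStable_iff.1 hL μ _ hy (by
    rw [complexify_add, Matrix.add_mulVec, complexify_mul, ← Matrix.mulVec_mulVec, hCz,
      Matrix.mulVec_zero, add_zero, hAz])
  linarith

/-- For `|σ| ≥ 1` the matrix `M (I - (1 - σ) VᵀV)` does not decrease the Euclidean norm, so none
of its eigenvalues lies in the open unit disk; and it has one, because the orthogonal part of `A`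
is not empty. -/
theorem not_schurStable_of_one_le_norm (hA : ¬ SchurStable (complexify A))
    (h : IsSplitting A U W M X) (hV : V * Vᵀ = 1)
    (hr : LinearMap.range Vᵀ.mulVecLin = LinearMap.range (Uᵀ * Cᵀ).mulVecLin)
    (hG : G * (C * U * Vᵀ) = 1) {σ : ℂ} (hσ : 1 ≤ ‖σ‖) :
    ¬ SchurStable (complexify A + (1 - σ) • complexify (-(U * M * Vᵀ * G) * C)) := by
  obtain ⟨z₀, hz₀⟩ : ∃ z₀ : Fin n₁ → ℂ, z₀ ≠ 0 := by
    rw [schurStable_iff] at hA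
    push Not at hA
    obtain ⟨μ, y, hy, hev, hμ⟩ := hA
    -- `σ = 1` turns the perturbed matrix into `A` itself
    obtain ⟨z, hz, -⟩ := exists_reduced_eigenvector (σ := 1) h hV hr hG hy hμ (by simpa using hev)
    exact ⟨z, hz⟩
  have : Nontrivial (Fin n₁ → ℂ) := ⟨_, _, hz₀⟩
  obtain ⟨μ, hμ⟩ := Module.End.exists_eigenvalue (Matrix.toLin'
    (complexify M * (1 - (1 - σ) • (complexify Vᵀ * complexify V))))
  obtain ⟨z, hzμ⟩ := hμ.exists_hasEigenvector
  have hMz : complexify M *ᵥ (z - (1 - σ) • (complexify Vᵀ *ᵥ (complexify V *ᵥ z))) = μ • z := by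
    have := hzμ.apply_eq_smul
    rwa [Matrix.toLin'_apply, ← Matrix.mulVec_mulVec, Matrix.sub_mulVec, Matrix.one_mulVec,
      Matrix.smul_mulVec, ← Matrix.mulVec_mulVec] at this
  have hnorm := normSq_reduced_eigenvector h.orthogonal hV hMz
  have hμ1 : 1 ≤ ‖μ‖ := by
    by_contra! hlt
    have h1 := normSq_pos hzμ.2
    have h2 := normSq_nonneg (complexify V *ᵥ z)
    have h3 : ‖μ‖ ^ 2 < 1 := by nlinarith [norm_nonneg μ]
    have h4 : 1 ≤ ‖σ‖ ^ 2 := one_le_pow₀ hσ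
    nlinarith
  intro hS
  have := schurStable_iff.1 hS μ (complexify U *ᵥ z)
    (fun h0 => hzμ.2 (h.mulVec_injective (h0.trans (Matrix.mulVec_zero _).symm)))
    (by rw [perturbed_mulVec_range h hV hr hG, hMz, Matrix.mulVec_smul])
  linarith

end Design

/-! ### The closed loop -/

section ClosedLoop

variable {N n : ℕ}

/-- The averaging operator `D ⊗ I` on families of `N` vectors. -/
def mixing (D : Matrix (Fin N) (Fin N) ℝ) : Module.End ℂ (Fin N → Fin n → ℂ) where
  toFun δ i := ∑ j, (D i j : ℂ) • δ j
  map_add' _ _ := by ext; simp [Finset.sum_add_distrib]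
  map_smul' _ _ := by ext; simp [Finset.mul_sum, mul_left_comm]

/-- The operator `I ⊗ A + (I - D) ⊗ P` on families of `N` vectors. With `P = L C` it governs the
estimation errors `vᵢ - xᵢ`. -/
def errorMap (A P : Matrix (Fin n) (Fin n) ℂ) (D : Matrix (Fin N) (Fin N) ℝ) :
    Module.End ℂ (Fin N → Fin n → ℂ) where
  toFun δ i := A *ᵥ δ i + P *ᵥ (δ i - mixing D δ i)
  map_add' _ _ := by
    ext; simp only [map_add, Pi.add_apply, Matrix.mulVec_add, Matrix.mulVec_sub, Pi.sub_apply]; ring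
  map_smul' c δ := by
    ext i : 1
    simp only [map_smul, Pi.smul_apply, ← smul_sub, Matrix.mulVec_smul, RingHom.id_apply, smul_add]

/-- The families whose members are all equal. -/
def agreement (N n : ℕ) : Submodule ℂ (Fin N → Fin n → ℂ) where
  carrier := {δ | ∀ i j, δ i = δ j}
  add_mem' h₁ h₂ i j := by rw [Pi.add_apply, Pi.add_apply, h₁ i j, h₂ i j]
  zero_mem' _ _ := rfl
  smul_mem' c _ h i j := by rw [Pi.smul_apply, Pi.smul_apply, h i j]

theorem mem_agreement {δ : Fin N → Fin n → ℂ} : δ ∈ agreement N n ↔ ∀ i j, δ i = δ j := Iff.rfl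

theorem mixing_apply (D : Matrix (Fin N) (Fin N) ℝ) (δ : Fin N → Fin n → ℂ) (i : Fin N) :
    mixing D δ i = ∑ j, (D i j : ℂ) • δ j := rfl

theorem errorMap_apply (A P : Matrix (Fin n) (Fin n) ℂ) (D : Matrix (Fin N) (Fin N) ℝ)
    (δ : Fin N → Fin n → ℂ) (i : Fin N) :
    errorMap A P D δ i = A *ᵥ δ i + P *ᵥ (δ i - mixing D δ i) := rfl

theorem mixing_mulVec (D : Matrix (Fin N) (Fin N) ℝ) (Q : Matrix (Fin n) (Fin n) ℂ)
    (δ : Fin N → Fin n → ℂ) (i : Fin N) :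
    mixing D (fun i => Q *ᵥ δ i) i = Q *ᵥ mixing D δ i := by
  simp only [mixing_apply, Matrix.mulVec_sum, Matrix.mulVec_smul]

theorem errorMap_mixing (A P : Matrix (Fin n) (Fin n) ℂ) (D : Matrix (Fin N) (Fin N) ℝ)
    (δ : Fin N → Fin n → ℂ) :
    errorMap A P D (mixing D δ) = mixing D (errorMap A P D δ) := by
  have h : errorMap A P D δ =
      (fun i => A *ᵥ δ i) + (fun i => P *ᵥ δ i) - fun i => P *ᵥ mixing D δ i := by
    ext i : 1
    simp [errorMap_apply, Matrix.mulVec_sub, add_sub_assoc]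
  rw [h, map_sub, map_add]
  ext i : 1
  simp only [errorMap_apply, Pi.add_apply, Pi.sub_apply, mixing_mulVec, Matrix.mulVec_sub,
    add_sub_assoc]

variable {D : Matrix (Fin N) (Fin N) ℝ}

theorem mixing_eq_self (hD : ∀ i, ∑ j, D i j = 1) {δ : Fin N → Fin n → ℂ}
    (hδ : δ ∈ agreement N n) : mixing D δ = δ := by
  ext i : 1
  have h : ∑ j, (D i j : ℂ) = 1 := by exact_mod_cast hD i
  rw [mixing_apply, Finset.sum_congr rfl fun j _ => by rw [mem_agreement.1 hδ j i],
    ← Finset.sum_smul, h, one_smul]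

/-- Modulo agreement, an eigenvector of the error dynamics can be taken to be an eigenvector of
`D ⊗ I` as well. The eigenvalue `σ` of the latter satisfies `|σ| < 1`, and the differences between
the agents' components are eigenvectors of `A + (1 - σ) P`. -/
theorem norm_lt_one_of_errorMap_eigenvector {A P : Matrix (Fin n) (Fin n) ℂ}
    (hAP : ∀ σ : ℂ, ‖σ‖ < 1 → SchurStable (A + (1 - σ) • P)) {G : Digraph (Fin N)}
    (hD : IsRowStochasticOf G D) {root : Fin N}
    (hroot : ∀ j, Relation.ReflTransGen G.Adj root j) {μ : ℂ} {δ : Fin N → Fin n → ℂ}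
    (hδ : δ ∉ agreement N n) (hμ : errorMap A P D δ - μ • δ ∈ agreement N n) : ‖μ‖ < 1 := by
  obtain ⟨y, σ, hy, hyA, hyD⟩ := exists_common_eigenvector_mod (f := errorMap A P D)
    (g := mixing D) (S := agreement N n) (errorMap_mixing A P D)
    (fun x hx i j => by
      simp only [errorMap_apply, mixing_eq_self hD.row_sum hx, mem_agreement.1 hx i j])
    (fun x hx => by rwa [mixing_eq_self hD.row_sum hx]) hδ hμ
  have hσ : ‖σ‖ < 1 := by
    by_contra! hσ
    refine hy fun i j => funext fun a => ?_
    refine eq_of_stochastic_eigenvector_mod_const hD hroot (w := fun i => y i a) (σ := σ)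
      (c := (mixing D y - σ • y) root a) (fun i => ?_) hσ i j
    have := congrFun (mem_agreement.1 hyD i root) a
    simp only [Pi.sub_apply, Pi.smul_apply, mixing_apply, Finset.sum_apply, smul_eq_mul] at this ⊢
    linear_combination this
  obtain ⟨i, j, hij⟩ : ∃ i j, y i ≠ y j := by
    by_contra! h
    exact hy h
  refine schurStable_iff.1 (hAP σ hσ) μ (y i - y j) (sub_ne_zero.2 hij) ?_
  have h1 := mem_agreement.1 hyA i j
  have h2 := congrArg (fun x => P *ᵥ x) (mem_agreement.1 hyD i j)
  simp only [Pi.sub_apply, Pi.smul_apply, errorMap_apply, Matrix.mulVec_sub,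
    Matrix.mulVec_smul] at h1 h2
  rw [Matrix.add_mulVec, Matrix.smul_mulVec, Matrix.mulVec_sub, Matrix.mulVec_sub]
  ext a
  have h1 := congrFun h1 a
  have h2 := congrFun h2 a
  simp only [Pi.add_apply, Pi.sub_apply, Pi.smul_apply, smul_eq_mul] at h1 h2 ⊢
  linear_combination h1 + h2

/-- The closed loop in the coordinates `(vᵢ - xᵢ, vᵢ)`: the errors evolve on their own, and drive
the protocol states only through their deviation from the average. -/
def closedLoopMap (A P K : Matrix (Fin n) (Fin n) ℂ) (D : Matrix (Fin N) (Fin N) ℝ) :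
    Module.End ℂ ((Fin N → Fin n → ℂ) × (Fin N → Fin n → ℂ)) :=
  LinearMap.prod (errorMap A P D ∘ₗ LinearMap.fst ℂ _ _)
    (errorMap 0 P D ∘ₗ LinearMap.fst ℂ _ _ + errorMap K 0 D ∘ₗ LinearMap.snd ℂ _ _)

theorem tendsto_closedLoopMap {A P K : Matrix (Fin n) (Fin n) ℂ}
    (hAP : ∀ σ : ℂ, ‖σ‖ < 1 → SchurStable (A + (1 - σ) • P)) (hK : SchurStable K)
    {G : Digraph (Fin N)} (hD : IsRowStochasticOf G D) {root : Fin N}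
    (hroot : ∀ j, Relation.ReflTransGen G.Adj root j)
    (s : (Fin N → Fin n → ℂ) × (Fin N → Fin n → ℂ)) (i j : Fin N) (a : Fin n) :
    Tendsto (fun k => (((closedLoopMap A P K D ^ k) s).2 i a - ((closedLoopMap A P K D ^ k) s).1 i a)
      - (((closedLoopMap A P K D ^ k) s).2 j a - ((closedLoopMap A P K D ^ k) s).1 j a))
      atTop (𝓝 0) := by
  have hagree : ∀ (Q : Matrix (Fin n) (Fin n) ℂ) (δ : Fin N → Fin n → ℂ), δ ∈ agreement N n →
      errorMap Q P D δ = fun i => Q *ᵥ δ i := by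
    intro Q δ hδ
    ext i : 1
    rw [errorMap_apply, mixing_eq_self hD.row_sum hδ, sub_self, Matrix.mulVec_zero, add_zero]
  let coord (i : Fin N) : Module.Dual ℂ (Fin N → Fin n → ℂ) :=
    LinearMap.proj a ∘ₗ LinearMap.proj i
  let φ : Module.Dual ℂ ((Fin N → Fin n → ℂ) × (Fin N → Fin n → ℂ)) :=
    (coord i ∘ₗ LinearMap.snd ℂ _ _ - coord i ∘ₗ LinearMap.fst ℂ _ _) -
      (coord j ∘ₗ LinearMap.snd ℂ _ _ - coord j ∘ₗ LinearMap.fst ℂ _ _)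
  refine tendsto_functional_of_eigenvalues_mod (f := closedLoopMap A P K D)
    (S := (agreement N n).prod ⊥) (φ := φ) ?_ ?_ ?_ s
  · rintro ⟨δ, v⟩ ⟨(hδ : δ ∈ agreement N n), hv⟩
    obtain rfl : v = 0 := hv
    refine ⟨?_, ?_⟩
    · intro i j
      simp [closedLoopMap, hagree A δ hδ, mem_agreement.1 hδ i j]
    · ext i
      simp [closedLoopMap, hagree 0 δ hδ]
  · rintro μ ⟨δ, v⟩ hs ⟨h1, h2⟩
    by_cases hδ : δ ∈ agreement N n
    · obtain ⟨i, hi⟩ : ∃ i, v i ≠ 0 := by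
        by_contra! h
        exact hs ⟨hδ, funext h⟩
      refine schurStable_iff.1 hK μ _ hi ?_
      have := congrFun ((Submodule.mem_bot ℂ).1 h2) i
      simpa [closedLoopMap, hagree 0 δ hδ, errorMap_apply, sub_eq_zero] using this
    · exact norm_lt_one_of_errorMap_eigenvector hAP hD hroot hδ h1
  · rintro ⟨δ, v⟩ ⟨(hδ : δ ∈ agreement N n), hv⟩
    obtain rfl : v = 0 := hv
    simp [φ, coord, congrFun (mem_agreement.1 hδ i j) a]

/-- Consensus requires only the stability of `A + B K` and of `A + (1 - σ) L C` on the open disk. -/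
theorem solvesConsensus {p q : ℕ} {A : Matrix (Fin n) (Fin n) ℝ} {B : Matrix (Fin n) (Fin p) ℝ}
    {C : Matrix (Fin q) (Fin n) ℝ} {K : Matrix (Fin p) (Fin n) ℝ} {L : Matrix (Fin n) (Fin q) ℝ}
    (hL : ∀ σ : ℂ, ‖σ‖ < 1 → SchurStable (complexify A + (1 - σ) • complexify (L * C)))
    (hK : SchurStable (complexify (A + B * K))) {G : Digraph (Fin N)}
    (hD : IsRowStochasticOf G D) {root : Fin N}
    (hroot : ∀ j, Relation.ReflTransGen G.Adj root j) : SolvesConsensus A B C K L D := by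
  intro x v hxv i j
  let F := closedLoopMap (complexify A) (complexify (L * C)) (complexify (A + B * K)) D
  let s : ℕ → (Fin N → Fin n → ℂ) × (Fin N → Fin n → ℂ) := fun k =>
    (fun i a => ((v k i - x k i) a : ℂ), fun i a => (v k i a : ℂ))
  have hmix : ∀ k i, (s k).1 i - mixing D (s k).1 i =
      fun a => ((∑ j, D i j • ((v k i - x k i) - (v k j - x k j))) a : ℂ) := by
    intro k i
    ext a
    have h : (∑ j, (D i j : ℂ)) = 1 := by exact_mod_cast hD.row_sum i
    simp only [mixing_apply, s, Pi.sub_apply, Finset.sum_apply, Pi.smul_apply, smul_eq_mul]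
    push_cast
    simp only [mul_sub, Finset.sum_sub_distrib, ← Finset.sum_mul, h]
    ring
  have hprot : ∀ k i, v (k + 1) i = (A + B * K) *ᵥ v k i +
      (L * C) *ᵥ ∑ j, D i j • ((v k i - x k i) - (v k j - x k j)) := by
    intro k i
    rw [hxv.protocol, relMeasurement, ← Finset.sum_sub_distrib, ← Matrix.mulVec_mulVec,
      Matrix.mulVec_sum C]
    congr 2
    refine Finset.sum_congr rfl fun j _ => ?_
    rw [Matrix.mulVec_smul, ← smul_sub, Matrix.mulVec_sub, Matrix.mulVec_sub, Matrix.mulVec_sub,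
      Matrix.mulVec_sub]
    congr 1
    abel
  have hstep : ∀ k, s (k + 1) = F (s k) := by
    intro k
    refine Prod.ext (funext fun i => ?_) (funext fun i => ?_)
    · have h : (F (s k)).1 i = errorMap (complexify A) (complexify (L * C)) D (s k).1 i := rfl
      rw [h, errorMap_apply, hmix, complexify_mulVec, complexify_mulVec]
      ext a
      change (((v (k + 1) i - x (k + 1) i) a : ℝ) : ℂ) = _
      rw [hprot, hxv.agent, Matrix.add_mulVec, ← Matrix.mulVec_mulVec, Matrix.mulVec_sub]
      simp only [Pi.add_apply, Pi.sub_apply]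
      push_cast
      ring
    · have h : (F (s k)).2 i = errorMap 0 (complexify (L * C)) D (s k).1 i +
          errorMap (complexify (A + B * K)) 0 D (s k).2 i := rfl
      rw [h, errorMap_apply, errorMap_apply, hmix, complexify_mulVec, Matrix.zero_mulVec,
        Matrix.zero_mulVec, add_zero, zero_add]
      change (fun a => (v (k + 1) i a : ℂ)) =
        _ + complexify (A + B * K) *ᵥ (fun a => (v k i a : ℂ))
      rw [complexify_mulVec]
      ext a
      rw [hprot]
      simp only [Pi.add_apply]
      push_cast
      ring
  have hs : ∀ k, s k = (F ^ k) (s 0) := by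
    intro k
    induction k with
    | zero => simp
    | succ k ih => rw [hstep, ih, pow_succ', Module.End.mul_apply]
  have hlim : Tendsto (fun k => x k i - x k j) atTop (𝓝 0) := by
    rw [tendsto_pi_nhds]
    intro a
    have := tendsto_closedLoopMap hL hK hD hroot (s 0) i j a
    simp only [show closedLoopMap _ _ _ D = F from rfl, ← hs] at this
    have := (Complex.continuous_re.tendsto 0).comp this
    simpa [s, Function.comp_def] using this
  have := ((PiLp.continuous_toLp 2 fun _ : Fin n => ℝ).norm.tendsto 0).comp hlim
  simpa [Function.comp_def] using this

end ClosedLoop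

/-! ### Orthonormal bases for a positive definite form -/

section OrthonormalBasis

variable {E : Type*} [AddCommGroup E] [Module ℝ E]

theorem exists_basis_orthonormal_for_form [FiniteDimensional ℝ E] (Q : E →ₗ[ℝ] E →ₗ[ℝ] ℝ)
    (hsymm : ∀ x y, Q x y = Q y x) (hpos : ∀ x, x ≠ 0 → 0 < Q x x) :
    ∃ b : Module.Basis (Fin (Module.finrank ℝ E)) ℝ E,
      ∀ i j, Q (b i) (b j) = (1 : Matrix _ _ ℝ) i j := by
  have hnonneg : ∀ x, 0 ≤ Q x x := fun x => by
    by_cases hx : x = 0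
    · simp [hx]
    · exact (hpos x hx).le
  let core : InnerProductSpace.Core ℝ E :=
    { inner := fun x y => Q x y
      conj_inner_symm := fun x y => by simpa using hsymm y x
      re_inner_nonneg := fun x => by simpa using hnonneg x
      add_left := fun x y z => by simp
      smul_left := fun x y r => by simp
      definite := fun x hx => by
        by_contra h
        exact (hpos x h).ne' hx }
  let : NormedAddCommGroup E := core.toNormedAddCommGroup
  let : InnerProductSpace ℝ E := InnerProductSpace.ofCore core.toCore
  refine ⟨(stdOrthonormalBasis ℝ E).toBasis, fun i j => ?_⟩
  have := orthonormal_iff_ite.1 (stdOrthonormalBasis ℝ E).orthonormal i j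
  rw [OrthonormalBasis.coe_toBasis, Matrix.one_apply]
  exact this

theorem toMatrix_mem_orthogonalGroup {k : ℕ} {Q : E →ₗ[ℝ] E →ₗ[ℝ] ℝ} {b : Module.Basis (Fin k) ℝ E}
    (hb : ∀ i j, Q (b i) (b j) = (1 : Matrix _ _ ℝ) i j) {f : Module.End ℝ E}
    (hf : ∀ x y, Q (f x) (f y) = Q x y) :
    LinearMap.toMatrix b b f ∈ Matrix.orthogonalGroup (Fin k) ℝ := by
  rw [Matrix.mem_orthogonalGroup_iff']
  ext j l
  have hexp : ∀ j, f (b j) = ∑ i, LinearMap.toMatrix b b f i j • b i := fun j => by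
    simp only [LinearMap.toMatrix_apply, b.sum_repr]
  rw [← hb j l, ← hf, hexp j, hexp l]
  simp [hb, Matrix.mul_apply, Matrix.one_apply, mul_comm]

end OrthonormalBasis

/-! ### Eigenvectors on the unit circle -/

section UnitSpectrum

variable {V : Type*} [AddCommGroup V] [Module ℂ V]

/-- The span of the eigenvectors of `f` for eigenvalues of modulus one. -/
def unitSpan (f : Module.End ℂ V) : Submodule ℂ V :=
  Submodule.span ℂ {x | ∃ μ : ℂ, ‖μ‖ = 1 ∧ f x = μ • x}

theorem map_mem_unitSpan {f : Module.End ℂ V} {x : V} (hx : x ∈ unitSpan f) :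
    f x ∈ unitSpan f := by
  refine Submodule.span_le.2 (?_ : _ ⊆ ((unitSpan f).comap f : Set V)) hx
  rintro y ⟨μ, hμ, hy⟩
  change f y ∈ unitSpan f
  exact hy ▸ Submodule.smul_mem _ μ (Submodule.subset_span ⟨μ, hμ, hy⟩)

/-- Coordinates with respect to a basis of eigenvectors, extended to functionals on all of `V`. -/
theorem exists_unitSpan_coordinates [FiniteDimensional ℂ V] (f : Module.End ℂ V) :
    ∃ (k : ℕ) (ℓ : Fin k → Module.Dual ℂ V), (∀ i, ∃ μ : ℂ, ‖μ‖ = 1 ∧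
      ∀ x ∈ unitSpan f, ℓ i (f x) = μ * ℓ i x) ∧
      ∀ x ∈ unitSpan f, (∀ i, ℓ i x = 0) → x = 0 := by
  obtain ⟨s, hs, hspan, hli⟩ := exists_linearIndependent ℂ {x | ∃ μ : ℂ, ‖μ‖ = 1 ∧ f x = μ • x}
  replace hspan : Submodule.span ℂ (Set.range ((↑) : s → V)) = unitSpan f := by
    rw [Subtype.range_coe]; exact hspan
  have : Finite s := hli.finite
  obtain ⟨k, ⟨e⟩⟩ := Finite.exists_equiv_fin s
  let b : Module.Basis (Fin k) ℂ (unitSpan f) :=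
    ((Module.Basis.span hli).map (LinearEquiv.ofEq _ (unitSpan f) hspan)).reindex e
  have hb : ∀ i, ∃ μ : ℂ, ‖μ‖ = 1 ∧ f (b i) = μ • (b i : V) := by
    intro i
    have : (b i : V) = e.symm i := by
      rw [Module.Basis.reindex_apply, Module.Basis.map_apply, LinearEquiv.coe_ofEq_apply,
        Module.Basis.span_apply]
    rw [this]
    exact hs (e.symm i).2
  choose μ hμ hfb using hb
  choose ℓ hℓ using fun i => LinearMap.exists_extend (b.coord i)
  have hℓb : ∀ i (x : unitSpan f), ℓ i x = b.coord i x := fun i x => by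
    rw [← hℓ i]; rfl
  refine ⟨k, ℓ, fun i => ⟨μ i, hμ i, fun x hx => ?_⟩, fun x hx h => ?_⟩
  · have : ℓ i ∘ₗ f ∘ₗ (unitSpan f).subtype = μ i • (ℓ i ∘ₗ (unitSpan f).subtype) := by
      refine b.ext fun j => ?_
      simp only [LinearMap.comp_apply, Submodule.subtype_apply, hfb, map_smul,
        LinearMap.smul_apply, hℓb, Module.Basis.coord_apply, Module.Basis.repr_self, smul_eq_mul]
      by_cases hij : j = i
      · rw [hij]
      · simp [hij]
    exact LinearMap.congr_fun this ⟨x, hx⟩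
  · have : (⟨x, hx⟩ : unitSpan f) = 0 := b.ext_elem fun i => by
      simpa [hℓb i ⟨x, hx⟩] using (hℓb i ⟨x, hx⟩).symm.trans (h i)
    exact congrArg Subtype.val this

theorem eq_zero_of_tendsto_pow_mul {μ c : ℂ} (hμ : 1 ≤ ‖μ‖)
    (h : Tendsto (fun k : ℕ => μ ^ k * c) atTop (𝓝 0)) : c = 0 := by
  have h0 : ‖c‖ ≤ ‖(0 : ℂ)‖ := by
    refine ge_of_tendsto h.norm (Eventually.of_forall fun k => ?_)
    rw [norm_mul, norm_pow]
    exact le_mul_of_one_le_left (norm_nonneg c) (one_le_pow₀ hμ)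
  simpa using h0

theorem norm_lt_one_of_mem_decaying {f : Module.End ℂ V} {x : V} (hx : x ∈ decaying f)
    (hx0 : x ≠ 0) {μ : ℂ} (hμ : f x = μ • x) : ‖μ‖ < 1 := by
  by_contra! h
  refine hx0 ((Module.forall_dual_apply_eq_zero_iff ℂ x).1 fun φ =>
    eq_zero_of_tendsto_pow_mul h ((hx φ).congr fun k => ?_))
  have : (f ^ k) x = μ ^ k • x := by
    induction k with
    | zero => simp
    | succ k ih => rw [pow_succ, Module.End.mul_apply, hμ, map_smul, ih, smul_smul, pow_succ']
  rw [this, map_smul, smul_eq_mul]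

theorem disjoint_unitSpan_decaying [FiniteDimensional ℂ V] (f : Module.End ℂ V) :
    Disjoint (unitSpan f) (decaying f) := by
  rw [Submodule.disjoint_def]
  intro x hx hxd
  obtain ⟨k, ℓ, hℓ, hinj⟩ := exists_unitSpan_coordinates f
  refine hinj x hx fun i => ?_
  obtain ⟨μ, hμ, hmul⟩ := hℓ i
  refine eq_zero_of_tendsto_pow_mul hμ.ge ((hxd (ℓ i)).congr fun k => ?_)
  clear hxd
  induction k generalizing x with
  | zero => simp
  | succ k ih =>
    rw [pow_succ, Module.End.mul_apply, ih _ (map_mem_unitSpan hx), hmul x hx, pow_succ, mul_assoc]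

end UnitSpectrum

/-! ### The real splitting and its invariant inner product -/

section RealForm

variable {n : ℕ}

/-- The real vectors in a complex subspace. -/
noncomputable def realPoints (S : Submodule ℂ (Fin n → ℂ)) : Submodule ℝ (Fin n → ℝ) :=
  (S.restrictScalars ℝ).comap (Complex.ofRealLI.toLinearMap.compLeft (Fin n))

theorem mem_realPoints {S : Submodule ℂ (Fin n → ℂ)} {x : Fin n → ℝ} :
    x ∈ realPoints S ↔ (fun i => (x i : ℂ)) ∈ S := Iff.rfl

theorem isCompl_realPoints {S T : Submodule ℂ (Fin n → ℂ)} (h : IsCompl S T)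
    (hS : ∀ x ∈ S, star x ∈ S) (hT : ∀ x ∈ T, star x ∈ T) :
    IsCompl (realPoints S) (realPoints T) := by
  have hre : ∀ R : Submodule ℂ (Fin n → ℂ), (∀ x ∈ R, star x ∈ R) → ∀ x ∈ R,
      (fun i => (x i).re) ∈ realPoints R := by
    intro R hR x hx
    rw [mem_realPoints]
    convert R.smul_mem (1 / 2 : ℂ) (R.add_mem hx (hR x hx)) using 1
    ext i
    have := Complex.add_conj (x i)
    simp only [Pi.smul_apply, Pi.add_apply, Pi.star_apply, Complex.star_def, this, smul_eq_mul]
    push_cast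
    ring
  constructor
  · rw [Submodule.disjoint_def]
    intro x hxS hxT
    have := Submodule.disjoint_def.1 h.disjoint _ (mem_realPoints.1 hxS) (mem_realPoints.1 hxT)
    ext i
    simpa using congrFun this i
  · rw [codisjoint_iff, Submodule.eq_top_iff']
    intro x
    obtain ⟨a, ha, b, hb, hab⟩ := Submodule.mem_sup.1
      (h.sup_eq_top ▸ Submodule.mem_top : (fun i => (x i : ℂ)) ∈ S ⊔ T)
    refine Submodule.mem_sup.2 ⟨_, hre S hS a ha, _, hre T hT b hb, ?_⟩
    ext i
    simpa using congrArg Complex.re (congrFun hab i)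

variable (A : Matrix (Fin n) (Fin n) ℝ)

theorem complexify_mulVec_star (x : Fin n → ℂ) :
    complexify A *ᵥ star x = star (complexify A *ᵥ x) := by
  ext; simp [complexify, Matrix.mulVec, dotProduct]

theorem star_mem_unitSpan {x : Fin n → ℂ} (hx : x ∈ unitSpan (Matrix.toLin' (complexify A))) :
    star x ∈ unitSpan (Matrix.toLin' (complexify A)) := by
  induction hx using Submodule.span_induction with
  | mem x hx =>
    obtain ⟨μ, hμ, hx⟩ := hx
    refine Submodule.subset_span ⟨star μ, by simpa using hμ, ?_⟩
    rw [Matrix.toLin'_apply] at hx ⊢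
    rw [complexify_mulVec_star, hx, star_smul]
  | zero => simp
  | add x y _ _ hx hy => rw [star_add]; exact add_mem hx hy
  | smul c x _ hx => rw [star_smul]; exact Submodule.smul_mem _ _ hx

theorem star_mem_decaying {x : Fin n → ℂ} (hx : x ∈ decaying (Matrix.toLin' (complexify A))) :
    star x ∈ decaying (Matrix.toLin' (complexify A)) := by
  intro φ
  have hpow : ∀ k, (Matrix.toLin' (complexify A) ^ k) (star x) =
      star ((Matrix.toLin' (complexify A) ^ k) x) := by
    intro k
    induction k with
    | zero => simp
    | succ k ih =>
      rw [pow_succ', Module.End.mul_apply, Module.End.mul_apply, ih, Matrix.toLin'_apply,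
        Matrix.toLin'_apply, complexify_mulVec_star]
  let ψ : Module.Dual ℂ (Fin n → ℂ) :=
    { toFun := fun y => star (φ (star y))
      map_add' := fun _ _ => by simp
      map_smul' := fun _ _ => by simp }
  have := (continuous_star.tendsto (0 : ℂ)).comp (hx ψ)
  simpa [ψ, hpow, Function.comp_def] using this

/-- For a neutrally stable matrix the generalized eigenspaces at the unit circle consist of
eigenvectors, and all the others decay. -/
theorem NeutrallyStable.isCompl {A : Matrix (Fin n) (Fin n) ℂ} (hA : NeutrallyStable A) :
    IsCompl (unitSpan (Matrix.toLin' A)) (decaying (Matrix.toLin' A)) := by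
  refine ⟨disjoint_unitSpan_decaying _, codisjoint_iff.2 (eq_top_of_maxGenEigenspace_le
    (f := Matrix.toLin' A) fun μ hμ => ?_)⟩
  obtain ⟨hle, heq⟩ := hA μ hμ
  rcases hle.lt_or_eq with hlt | h1
  · exact (maxGenEigenspace_le_decaying _ hlt).trans le_sup_right
  · rw [heq h1]
    exact le_sup_of_le_left fun x hx =>
      Submodule.subset_span ⟨μ, h1, Module.End.mem_eigenspace_iff.1 hx⟩

/-- On the real points of `unitSpan A` the form is `Re ∑ ℓᵢ(x) conj (ℓᵢ(y))`, where the `ℓᵢ` are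
coordinates with respect to a basis of complex eigenvectors. It is invariant because each `ℓᵢ` is
multiplied by a number of modulus one. -/
theorem exists_invariant_inner :
    ∃ Q : realPoints (unitSpan (Matrix.toLin' (complexify A))) →ₗ[ℝ]
        realPoints (unitSpan (Matrix.toLin' (complexify A))) →ₗ[ℝ] ℝ,
      (∀ x y, Q x y = Q y x) ∧ (∀ x, x ≠ 0 → 0 < Q x x) ∧
      ∀ x y x' y' : realPoints (unitSpan (Matrix.toLin' (complexify A))),
        (x' : Fin n → ℝ) = A *ᵥ x → (y' : Fin n → ℝ) = A *ᵥ y → Q x' y' = Q x y := by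
  obtain ⟨k, ℓ, hℓ, hinj⟩ := exists_unitSpan_coordinates (Matrix.toLin' (complexify A))
  set S := realPoints (unitSpan (Matrix.toLin' (complexify A)))
  let c : Fin k → S →ₗ[ℝ] ℂ := fun i =>
    (ℓ i).restrictScalars ℝ ∘ₗ Complex.ofRealLI.toLinearMap.compLeft (Fin n) ∘ₗ S.subtype
  have hc : ∀ i (x : S), c i x = ℓ i fun j => ((x : Fin n → ℝ) j : ℂ) := fun _ _ => rfl
  let Q : S →ₗ[ℝ] S →ₗ[ℝ] ℝ := LinearMap.mk₂ ℝ (fun x y => ∑ i, (c i x * star (c i y)).re)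
    (fun x y z => by
      simp only [map_add, add_mul, Complex.add_re, Finset.sum_add_distrib])
    (fun r x y => by
      simp only [map_smul, smul_mul_assoc, Complex.smul_re, ← Finset.smul_sum])
    (fun x y z => by
      simp only [map_add, star_add, mul_add, Complex.add_re, Finset.sum_add_distrib])
    (fun r x y => by
      simp only [map_smul, star_smul, star_trivial, mul_smul_comm, Complex.smul_re,
        ← Finset.smul_sum])
  have hQ : ∀ x y, Q x y = ∑ i, (c i x * star (c i y)).re := fun _ _ => rfl
  refine ⟨Q, fun x y => ?_, fun x hx => ?_, fun x y x' y' hx hy => ?_⟩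
  · rw [hQ, hQ]
    refine Finset.sum_congr rfl fun i _ => ?_
    simp only [Complex.star_def, Complex.mul_re, Complex.conj_re, Complex.conj_im]
    ring
  · have hsq : ∀ i, (c i x * star (c i x)).re = ‖c i x‖ ^ 2 := fun i => by
      rw [Complex.star_def, Complex.mul_conj']
      norm_cast
    simp only [hQ, hsq]
    refine lt_of_le_of_ne (Finset.sum_nonneg fun _ _ => sq_nonneg _) fun h => hx ?_
    have h0 := (Finset.sum_eq_zero_iff_of_nonneg fun i _ => sq_nonneg ‖c i x‖).1 h.symm
    have := hinj _ (mem_realPoints.1 x.2) fun i => by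
      simpa [hc] using h0 i (Finset.mem_univ i)
    ext j
    simpa using congrFun this j
  · have hmul : ∀ i, ∃ μ : ℂ, μ * star μ = 1 ∧ ∀ z z' : S, (z' : Fin n → ℝ) = A *ᵥ z →
        c i z' = μ * c i z := by
      intro i
      obtain ⟨μ, hμ, h⟩ := hℓ i
      refine ⟨μ, by rw [Complex.star_def, Complex.mul_conj', hμ]; simp, fun z z' hz => ?_⟩
      rw [hc, hc, ← h _ (mem_realPoints.1 z.2), hz, Matrix.toLin'_apply, complexify_mulVec]
    rw [hQ, hQ]
    refine Finset.sum_congr rfl fun i _ => ?_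
    obtain ⟨μ, hμ, h⟩ := hmul i
    rw [h x x' hx, h y y' hy, star_mul']
    congr 1
    linear_combination (c i x * star (c i y)) * hμ

end RealForm

/-! ### Existence of the construction -/

section Existence

variable {n k : ℕ}

/-- The matrix whose columns are the members of a basis of a subspace. -/
noncomputable def columns {S : Submodule ℝ (Fin n → ℝ)} (b : Module.Basis (Fin k) ℝ S) :
    Matrix (Fin n) (Fin k) ℝ := Matrix.of fun i j => (b j : Fin n → ℝ) i

theorem columns_mulVec {S : Submodule ℝ (Fin n → ℝ)} (b : Module.Basis (Fin k) ℝ S)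
    (z : Fin k → ℝ) : columns b *ᵥ z = (∑ j, z j • b j : S) := by
  ext i
  simp [columns, Matrix.mulVec, dotProduct, mul_comm]

theorem mul_columns {S : Submodule ℝ (Fin n → ℝ)} (b : Module.Basis (Fin k) ℝ S)
    {A : Matrix (Fin n) (Fin n) ℝ} {f : Module.End ℝ S}
    (hf : ∀ x, (f x : Fin n → ℝ) = A *ᵥ x) :
    A * columns b = columns b * LinearMap.toMatrix b b f := by
  apply Matrix.ext_of_mulVec_single
  intro j
  rw [← Matrix.mulVec_mulVec, ← Matrix.mulVec_mulVec, columns_mulVec, columns_mulVec]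
  have h1 : ∑ l, (Pi.single j 1 : Fin k → ℝ) l • b l = b j := by simp [Pi.single_apply]
  have h2 : ∑ l, (LinearMap.toMatrix b b f *ᵥ Pi.single j 1) l • b l = f (b j) := by
    simp only [Matrix.mulVec_single_one, Matrix.col_apply, LinearMap.toMatrix_apply, b.sum_repr]
  rw [h1, h2, hf]

theorem exists_inverse_fromCols {k₁ k₂ : ℕ} {S T : Submodule ℝ (Fin n → ℝ)} (h : IsCompl S T)
    (b₁ : Module.Basis (Fin k₁) ℝ S) (b₂ : Module.Basis (Fin k₂) ℝ T) :
    ∃ R : Matrix (Fin k₁ ⊕ Fin k₂) (Fin n) ℝ,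
      R * Matrix.fromCols (columns b₁) (columns b₂) = 1 ∧
        Matrix.fromCols (columns b₁) (columns b₂) * R = 1 := by
  let c := (b₁.prod b₂).map (Submodule.prodEquivOfIsCompl S T h)
  have hc : Matrix.fromCols (columns b₁) (columns b₂) = (Pi.basisFun ℝ (Fin n)).toMatrix c := by
    ext i (j | j) <;> simp [c, columns, Module.Basis.toMatrix_apply]
  rw [hc]
  exact ⟨c.toMatrix (Pi.basisFun ℝ (Fin n)), Module.Basis.toMatrix_mul_toMatrix_flip _ _,
    Module.Basis.toMatrix_mul_toMatrix_flip _ _⟩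

theorem exists_isSplitting {A : Matrix (Fin n) (Fin n) ℝ} (hA : NeutrallyStable (complexify A)) :
    ∃ (n₁ n₂ : ℕ) (U : Matrix (Fin n) (Fin n₁) ℝ) (W : Matrix (Fin n) (Fin n₂) ℝ)
      (M : Matrix (Fin n₁) (Fin n₁) ℝ) (X : Matrix (Fin n₂) (Fin n₂) ℝ),
      IsSplitting A U W M X := by
  have hcompl := isCompl_realPoints hA.isCompl (fun _ => star_mem_unitSpan A)
    (fun _ => star_mem_decaying A)
  set S := realPoints (unitSpan (Matrix.toLin' (complexify A)))
  set T := realPoints (decaying (Matrix.toLin' (complexify A)))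
  obtain ⟨Q, hsymm, hpos, hinv⟩ := exists_invariant_inner A
  have hAS : ∀ x ∈ S, Matrix.toLin' A x ∈ S := fun x hx => by
    have := map_mem_unitSpan (mem_realPoints.1 hx)
    rw [Matrix.toLin'_apply, complexify_mulVec] at this
    exact mem_realPoints.2 this
  have hAT : ∀ x ∈ T, Matrix.toLin' A x ∈ T := fun x hx => by
    have := map_mem_decaying (mem_realPoints.1 hx)
    rw [Matrix.toLin'_apply, complexify_mulVec] at this
    exact mem_realPoints.2 this
  obtain ⟨b₁, hb₁⟩ := exists_basis_orthonormal_for_form Q hsymm hpos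
  let b₂ := Module.finBasis ℝ T
  let f₁ := (Matrix.toLin' A).restrict hAS
  let f₂ := (Matrix.toLin' A).restrict hAT
  have hf₁ : ∀ x, (f₁ x : Fin n → ℝ) = A *ᵥ x := fun _ => rfl
  have hf₂ : ∀ x, (f₂ x : Fin n → ℝ) = A *ᵥ x := fun _ => rfl
  obtain ⟨R, hR₁, hR₂⟩ := exists_inverse_fromCols hcompl b₁ b₂
  refine ⟨_, _, columns b₁, columns b₂, LinearMap.toMatrix b₁ b₁ f₁, LinearMap.toMatrix b₂ b₂ f₂,
    ⟨R, hR₁, hR₂, ?_⟩, toMatrix_mem_orthogonalGroup hb₁ fun x y => hinv _ _ _ _ (hf₁ x) (hf₁ y), ?_⟩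
  · have : A * Matrix.fromCols (columns b₁) (columns b₂) =
        Matrix.fromCols (columns b₁) (columns b₂) * Matrix.fromBlocks
          (LinearMap.toMatrix b₁ b₁ f₁) 0 0 (LinearMap.toMatrix b₂ b₂ f₂) := by
      rw [Matrix.mul_fromCols, mul_columns b₁ hf₁, mul_columns b₂ hf₂,
        Matrix.fromCols_mul_fromBlocks]
      simp
    rw [Matrix.mul_assoc, this, ← Matrix.mul_assoc, hR₁, Matrix.one_mul]
  · rw [schurStable_iff]
    intro μ z hz hμ
    refine norm_lt_one_of_mem_decaying (f := Matrix.toLin' (complexify A))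
      (x := complexify (columns b₂) *ᵥ z) ?_ (fun h0 => hz ?_) ?_
    · have : complexify (columns b₂) *ᵥ z =
          ∑ j, z j • fun i => (((b₂ j : T) : Fin n → ℝ) i : ℂ) := by
        ext i
        simp [complexify, columns, Matrix.mulVec, dotProduct, mul_comm]
      rw [this]
      exact Submodule.sum_mem _ fun j _ => Submodule.smul_mem _ _ (mem_realPoints.1 (b₂ j).2)
    · obtain ⟨R₁, R₂, rfl⟩ : ∃ R₁ R₂, R = Matrix.fromRows R₁ R₂ :=
        ⟨_, _, (Matrix.fromRows_toRows R).symm⟩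
      rw [Matrix.fromRows_mul_fromCols, ← Matrix.fromBlocks_one, Matrix.fromBlocks_inj] at hR₁
      rw [← Matrix.one_mulVec z, ← complexify_one, ← hR₁.2.2.2, complexify_mul,
        ← Matrix.mulVec_mulVec, h0, Matrix.mulVec_zero]
    · rw [Matrix.toLin'_apply, Matrix.mulVec_mulVec, ← complexify_mul, mul_columns b₂ hf₂,
        complexify_mul, ← Matrix.mulVec_mulVec, hμ, Matrix.mulVec_smul]

theorem exists_orthonormal_rows {q : ℕ} (E : Matrix (Fin n) (Fin q) ℝ) :
    ∃ (m : ℕ) (V : Matrix (Fin m) (Fin n) ℝ), V * Vᵀ = 1 ∧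
      LinearMap.range Vᵀ.mulVecLin = LinearMap.range E.mulVecLin := by
  set S := LinearMap.range E.mulVecLin
  let Q : S →ₗ[ℝ] S →ₗ[ℝ] ℝ := (dotProductBilin ℝ ℝ).domRestrict₁₂ S S
  have hQ : ∀ x y : S, Q x y = (x : Fin n → ℝ) ⬝ᵥ y := fun _ _ => rfl
  obtain ⟨b, hb⟩ := exists_basis_orthonormal_for_form Q
    (fun x y => by rw [hQ, hQ, dotProduct_comm])
    (fun x hx => by
      rw [hQ]
      refine lt_of_le_of_ne (Finset.sum_nonneg fun _ _ => mul_self_nonneg _) fun h => hx ?_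
      exact Subtype.ext (dotProduct_self_eq_zero.1 h.symm))
  refine ⟨_, (columns b)ᵀ, ?_, ?_⟩
  · ext i j
    rw [← hb i j, hQ]
    rfl
  · rw [Matrix.transpose_transpose]
    apply le_antisymm
    · rintro _ ⟨z, rfl⟩
      rw [Matrix.mulVecLin_apply, columns_mulVec]
      exact Subtype.coe_prop _
    · intro x hx
      refine ⟨b.repr ⟨x, hx⟩, ?_⟩
      rw [Matrix.mulVecLin_apply, columns_mulVec, b.sum_repr]

theorem exists_left_inverse {m q : ℕ} {E : Matrix (Fin q) (Fin n) ℝ} {V : Matrix (Fin m) (Fin n) ℝ}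
    (hV : V * Vᵀ = 1)
    (hr : LinearMap.range Vᵀ.mulVecLin = LinearMap.range Eᵀ.mulVecLin) :
    ∃ G : Matrix (Fin m) (Fin q) ℝ, G * (E * Vᵀ) = 1 := by
  have hinj : LinearMap.ker (Matrix.toLin' (E * Vᵀ)) = ⊥ := by
    rw [LinearMap.ker_eq_bot']
    intro z hz
    rw [Matrix.toLin'_apply, ← Matrix.mulVec_mulVec] at hz
    obtain ⟨w, hw⟩ : Vᵀ *ᵥ z ∈ LinearMap.range Eᵀ.mulVecLin := hr ▸ ⟨z, rfl⟩
    rw [Matrix.mulVecLin_apply] at hw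
    -- `Vᵀ z` lies in the kernel of `E` and in the range of `Eᵀ`, which is orthogonal to it
    have h0 : Vᵀ *ᵥ z = 0 := by
      refine dotProduct_self_eq_zero.1 ?_
      nth_rewrite 1 [← hw]
      rw [Matrix.mulVec_transpose, ← Matrix.dotProduct_mulVec, hz, dotProduct_zero]
    rw [← Matrix.one_mulVec z, ← hV, ← Matrix.mulVec_mulVec, h0, Matrix.mulVec_zero]
  obtain ⟨g, hg⟩ := LinearMap.exists_leftInverse_of_injective _ hinj
  refine ⟨LinearMap.toMatrix' g, Matrix.toLin'.injective ?_⟩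
  rw [Matrix.toLin'_mul, Matrix.toLin'_toMatrix', hg, Matrix.toLin'_one]

theorem exists_isDesign {p q : ℕ} {A : Matrix (Fin n) (Fin n) ℝ} {B : Matrix (Fin n) (Fin p) ℝ}
    {C : Matrix (Fin q) (Fin n) ℝ} (hA : NeutrallyStable (complexify A)) (hAB : Stabilizable A B) :
    ∃ (K : Matrix (Fin p) (Fin n) ℝ) (L : Matrix (Fin n) (Fin q) ℝ), IsDesign A B C K L := by
  obtain ⟨K, hK⟩ := hAB
  obtain ⟨n₁, n₂, U, W, M, X, h⟩ := exists_isSplitting hA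
  obtain ⟨m, V, hV, hr⟩ := exists_orthonormal_rows (Uᵀ * Cᵀ)
  obtain ⟨G, hG⟩ := exists_left_inverse (E := C * U) hV (by rwa [Matrix.transpose_mul])
  exact ⟨K, _, hK, n₁, n₂, m, U, W, M, X, V, G, h, hV, hr, hG, rfl⟩

end Existence

end Consensus

theorem theorem3 {n p q : ℕ} (A : Matrix (Fin n) (Fin n) ℝ) (B : Matrix (Fin n) (Fin p) ℝ)
    (C : Matrix (Fin q) (Fin n) ℝ)
    (hA : Consensus.NeutrallyStable (Consensus.complexify A))
    (hAB : Consensus.Stabilizable A B) (hAC : Consensus.Detectable A C) :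
    (∃ (K : Matrix (Fin p) (Fin n) ℝ) (L : Matrix (Fin n) (Fin q) ℝ),
      Consensus.IsDesign A B C K L) ∧
    ∀ (K : Matrix (Fin p) (Fin n) ℝ) (L : Matrix (Fin n) (Fin q) ℝ),
      Consensus.IsDesign A B C K L →
      (∀ σ : ℂ, ‖σ‖ < 1 →
        Consensus.SchurStable
          (Consensus.complexify A + (1 - σ) • Consensus.complexify (L * C))) ∧
      (¬ Consensus.SchurStable (Consensus.complexify A) →
        Consensus.consensusRegion A C L = Metric.ball (0 : ℂ) 1) ∧
      (∀ (N : ℕ), ∀ G ∈ Consensus.spanningTreeGraphs N,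
        ∀ D : Matrix (Fin N) (Fin N) ℝ, Consensus.IsRowStochasticOf G D →
          Consensus.SolvesConsensus A B C K L D) := by
  refine ⟨Consensus.exists_isDesign hA hAB, ?_⟩
  rintro K L ⟨hK, n₁, n₂, m, U, W, M, X, V, G, h, hV, hr, hG, rfl⟩
  refine ⟨fun σ hσ => Consensus.schurStable_of_norm_lt_one hAC h hV hr hG hσ, fun hnot => ?_, ?_⟩
  · ext σ
    rw [mem_ball_zero_iff]
    refine ⟨fun hσ => ?_, fun hσ => Consensus.schurStable_of_norm_lt_one hAC h hV hr hG hσ⟩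
    by_contra! hle
    exact Consensus.not_schurStable_of_one_le_norm hnot h hV hr hG hle hσ
  · rintro N 𝒢 ⟨-, root, hroot⟩ D hD
    exact Consensus.solvesConsensus
      (fun σ hσ => Consensus.schurStable_of_norm_lt_one hAC h hV hr hG hσ) hK hD hroot
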